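/- There is an absolute constant $C>0$ such that the following holds. Let $d\in\mathbb N$ and let $F$ be a symmetric probability distribution on $\mathbb R^d$ (that is, $F\{A\}=F\{-A\}$ for all Borel sets $A$) with $\operatorname{supp}F\subset\mathbb Z^d$ and $q:=F\{0\}\in(0,1)$. For $y\ge 0$ put $$\delta(y)=\sum_{x\in\mathbb Z^d\setminus\{0\}}\min\bigl(1,\;y\,e\,F\{x\}\bigr),$$ where $e$ is Euler's number. Let $I$ be the distribution concentrated at $0\in\mathbb R^d$, let $*$ denote convolution of finite signed Borel measures on $\mathbb R^d$, with powers $M^{*j}$ ($M^{*0}=I$), and let $\exp\{M\}=\sum_{j\ge0}M^{*j}/j!$. Let $d_{TV}(M,V)=\sup_B|M\{B\}-V\{B\}|$, the supremum being over all Borel sets $B\subset\mathbb R^d$. Then, for every integer $n\ge1$, $$d_{TV}\Bigl(F^{*n},\ \exp\{n(F-I)\}*\bigl(I-\tfrac n2(F-I)^{*2}\bigr)\Bigr)\le\frac{C\bigl(\delta^3(nq)+\delta^4(nq)\bigr)}{q^{11/2}\,n^2}+\frac{C(1-q)^6}{q^{13/2}\,n^2}.$$ -/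

import Mathlib

open MeasureTheory

noncomputable section

namespace CPApprox

variable {E : Type*} [MeasurableSpace E]

/-- The convolution `M * V` of two finite signed measures: the image under addition of the
product signed measure (the one giving mass `M A * V B` to every rectangle `A × B`). -/
def conv [Add E] (M V : SignedMeasure E) : SignedMeasure E :=
  (M.prod V (ContinuousLinearMap.mul ℝ ℝ)).map (fun p : E × E => p.1 + p.2)

/-- The distribution `I` concentrated at the origin, as a signed measure. -/
def unit (E : Type*) [MeasurableSpace E] [Zero E] : SignedMeasure E :=
  (Measure.dirac (0 : E)).toSignedMeasure

/-- Convolution powers: `M^{*0} = I` and `M^{*(j+1)} = M^{*j} * M`. -/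
def convPow [Add E] [Zero E] (M : SignedMeasure E) : ℕ → SignedMeasure E
  | 0 => unit E
  | j + 1 => conv (convPow M j) M

instance isFiniteMeasure_variation (M : SignedMeasure E) : IsFiniteMeasure M.variation := by
  rw [← SignedMeasure.totalVariation_eq_variation]
  infer_instance

lemma variation_conv_univ_le [Add E] [MeasurableAdd₂ E] (M V : SignedMeasure E) :
    (conv M V).variation Set.univ ≤ M.variation Set.univ * V.variation Set.univ := by
  have hadd : Measurable (fun p : E × E => p.1 + p.2) := measurable_add
  have h1 := VectorMeasure.variation_map_le
    (μ := M.prod V (ContinuousLinearMap.mul ℝ ℝ)) (φ := fun p : E × E => p.1 + p.2) Set.univ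
  rw [Measure.map_apply hadd MeasurableSet.univ, Set.preimage_univ] at h1
  have h2 := VectorMeasure.variation_prod_le (μ := M) (ν := V)
    (B := ContinuousLinearMap.mul ℝ ℝ) Set.univ
  have h3 : ‖ContinuousLinearMap.mul ℝ ℝ‖ₑ ≤ 1 := by
    rw [← ofReal_norm, ← ENNReal.ofReal_one]
    exact ENNReal.ofReal_le_ofReal (ContinuousLinearMap.opNorm_mul_le ℝ ℝ)
  refine h1.trans (h2.trans ?_)
  rw [Measure.smul_apply, smul_eq_mul, ← Set.univ_prod_univ, Measure.prod_prod]
  exact mul_le_of_le_one_left' h3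

lemma variation_convPow_univ_le [AddZeroClass E] [MeasurableAdd₂ E] (M : SignedMeasure E)
    (j : ℕ) : (convPow M j).variation Set.univ ≤ M.variation Set.univ ^ j := by
  induction j with
  | zero => simp [convPow, unit]
  | succ j ih =>
    rw [pow_succ]
    exact (variation_conv_univ_le _ _).trans (mul_le_mul_left ih _)

lemma tsum_norm_le_variation (M : SignedMeasure E) {f : ℕ → Set E}
    (hf : ∀ i, MeasurableSet (f i)) (hd : Pairwise (Function.onFun Disjoint f)) :
    Summable (fun i => ‖M (f i)‖) ∧
      ∑' i, ‖M (f i)‖ ≤ (M.variation Set.univ).toReal := by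
  have hle : ∀ i, ‖M (f i)‖ ≤ (M.variation (f i)).toReal := fun i => by
    have h := ENNReal.toReal_mono (measure_ne_top _ _)
      (VectorMeasure.enorm_measure_le_variation M (f i))
    simpa using h
  have hsum : ∑' i, M.variation (f i) ≠ ⊤ := by
    rw [← measure_iUnion hd hf]
    exact measure_ne_top _ _
  have hs : Summable fun i => (M.variation (f i)).toReal := ENNReal.summable_toReal hsum
  have hs' : Summable (fun i => ‖M (f i)‖) :=
    hs.of_nonneg_of_le (fun _ => norm_nonneg _) hle
  refine ⟨hs', (hs'.tsum_le_tsum hle hs).trans ?_⟩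
  rw [← ENNReal.tsum_toReal_eq (fun _ => measure_ne_top _ _), ← measure_iUnion hd hf]
  exact ENNReal.toReal_mono (measure_ne_top _ _) (measure_mono (Set.subset_univ _))

/-- The exponential measure `exp{M} = ∑_{j ≥ 0} M^{*j} / j!`; the series converges absolutely
on every set. -/
def expMeasure [AddZeroClass E] [MeasurableAdd₂ E] (M : SignedMeasure E) : SignedMeasure E where
  measureOf' A := ∑' j : ℕ, convPow M j A / (j.factorial : ℝ)
  empty' := by simp
  not_measurable' A hA := by simp [VectorMeasure.not_measurable _ hA]
  m_iUnion' f hf hd := by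
    set m : ℝ := (M.variation Set.univ).toReal with hm
    have hbound : ∀ j, ((convPow M j).variation Set.univ).toReal ≤ m ^ j := fun j => by
      rw [hm, ← ENNReal.toReal_pow]
      exact ENNReal.toReal_mono (ENNReal.pow_ne_top (measure_ne_top _ _))
        (variation_convPow_univ_le M j)
    have hkey : Summable (fun p : ℕ × ℕ => convPow M p.1 (f p.2) / (p.1.factorial : ℝ)) := by
      apply Summable.of_norm
      rw [summable_prod_of_nonneg (fun _ => norm_nonneg _)]
      have hn : ∀ j i, ‖convPow M j (f i) / (j.factorial : ℝ)‖
          = ‖convPow M j (f i)‖ / (j.factorial : ℝ) := fun j i => by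
        rw [norm_div, Real.norm_natCast]
      simp only [hn]
      refine ⟨fun j => (tsum_norm_le_variation _ hf hd).1.div_const _, ?_⟩
      refine (Real.summable_pow_div_factorial m).of_nonneg_of_le
        (fun j => tsum_nonneg fun i => by positivity) (fun j => ?_)
      rw [tsum_div_const]
      gcongr
      exact (tsum_norm_le_variation _ hf hd).2.trans (hbound j)
    have hrow : ∀ j, HasSum (fun i => convPow M j (f i) / (j.factorial : ℝ))
        (convPow M j (⋃ i, f i) / (j.factorial : ℝ)) := fun j =>
      ((convPow M j).m_iUnion hf hd).div_const _
    have htot : ∑' p : ℕ × ℕ, convPow M p.1 (f p.2) / (p.1.factorial : ℝ)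
        = ∑' j, convPow M j (⋃ i, f i) / (j.factorial : ℝ) :=
      (hkey.hasSum.prod_fiberwise hrow).tsum_eq.symm
    have hswap : Summable (fun p : ℕ × ℕ => convPow M p.2 (f p.1) / (p.2.factorial : ℝ)) :=
      hkey.prod_symm
    have hs2 := hswap.hasSum.prod_fiberwise (fun i => (hswap.prod_factor i).hasSum)
    rw [← htot]
    convert hs2 using 1
    exact ((Equiv.prodComm ℕ ℕ).tsum_eq
      (fun p : ℕ × ℕ => convPow M p.1 (f p.2) / (p.1.factorial : ℝ))).symm

/-- The total variation distance `sup_B |M{B} - V{B}|`, over all measurable sets `B`. -/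
def tvDist (M V : SignedMeasure E) : ℝ :=
  ⨆ B : {B : Set E // MeasurableSet B}, |M B - V B|

/-- The point of `ℝ^d` with the integer coordinates `m`. -/
def latticePoint {d : ℕ} (m : Fin d → ℤ) : Fin d → ℝ := fun i => (m i : ℝ)

/-- `δ(y) = ∑_{x ∈ ℤ^d, x ≠ 0} min(1, y e F{x})`. -/
def delta {d : ℕ} (F : Measure (Fin d → ℝ)) (y : ℝ) : ℝ :=
  ∑' m : {m : Fin d → ℤ // m ≠ 0}, min 1 (y * Real.exp 1 * F.real {latticePoint m.1})

end CPApprox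

end

namespace CPApprox

/-! ### Smoothing by symmetric lazy walks in a Banach algebra -/

section Smoothing

/-! Measures on the lattice act on bounded functions on `ℤ^d` by averaging translations, and this
turns convolution into multiplication in a Banach algebra (`convOperator_conv`,
`convOperator_expMeasure`). Testing on an indicator function shows that the operator norm dominates
total variation distance (`tvDist_le_norm_convOperator_sub`). It remains to compare `T ^ n` with
`exp (n (T - 1)) (1 - (n/2) (T - 1) ^ 2)` for a contraction `T`.

Smallness comes from smoothing. By symmetry `2 (T - 1)` is the sum of `p x (U x + U (-x) - 2)`. For
each single `x` a lazy walk with steps `0, x, -x` splits off from `T`; binomial cancellation makes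
its second difference after `k` steps `O(1/(k+1))`, and the mass at `0` provides the laziness.
Choosing for each `x` the better of this and the trivial bound gives `‖(T - 1) T ^ k‖ ≤ 2 (1 +
n/(k+1)) D` with `D = ∑ min (p x) (1/(nq))`, at most `δ(nq)/(nq)` (`norm_sub_one_mul_pow_le`,
`tsum_min_le_delta_div`).

With `Φ = T - 1`, second-order telescoping against `exp Φ` leaves about `n²` terms containing `Φ ^
4` and `n` terms containing `Φ ^ 3`, the quadratic part being cancelled by the correction. Each
factor `Φ` gets its own share of the roughly `n` smoothing powers and costs `O(D)`, for a total of
`n D³ + n² D⁴` (`norm_pow_sub_exp_mul_le`). This already fits under the first summand of the claim.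
-/

lemma sum_choose_mul_sq (N : ℕ) :
    ∑ j ∈ Finset.range (N + 1), (N.choose j : ℝ) * (2 * (j : ℝ) - N) ^ 2 = (N : ℝ) * 2 ^ N := by
  -- The variance of a binomial variable with success probability `1/2`, to be rescaled by `4 * 2 ^
  -- N`.
  have h := congrArg (Polynomial.eval (1 / 2 : ℝ)) (bernsteinPolynomial.variance ℝ N)
  rw [Polynomial.eval_finsetSum] at h
  have h2 : ∀ j ∈ Finset.range (N + 1),
      Polynomial.eval (1 / 2 : ℝ)
        ((N • Polynomial.X - (j : Polynomial ℝ)) ^ 2 * bernsteinPolynomial ℝ N j)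
      = (N.choose j : ℝ) * (2 * (j : ℝ) - N) ^ 2 * (1 / (4 * 2 ^ N)) := by
    intro j hj
    have hjN : j ≤ N := by simpa [Nat.lt_succ_iff] using hj
    have e : (1 / 2 : ℝ) ^ j * (1 - 1 / 2) ^ (N - j) = 1 / 2 ^ N := by
      rw [show (1 - 1 / 2 : ℝ) = 1 / 2 by norm_num, ← pow_add, Nat.add_sub_cancel' hjN]
      simp
    simp only [bernsteinPolynomial, Polynomial.eval_mul, Polynomial.eval_pow, Polynomial.eval_sub,
      Polynomial.eval_natCast, Polynomial.eval_X, Polynomial.eval_one, nsmul_eq_mul]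
    rw [mul_assoc (N.choose j : ℝ), e]
    field_simp
    ring
  rw [Finset.sum_congr rfl h2, ← Finset.sum_mul] at h
  simp only [Polynomial.eval_mul, Polynomial.eval_sub, Polynomial.eval_natCast, Polynomial.eval_X,
    Polynomial.eval_one, nsmul_eq_mul] at h
  have h4 : (4 * 2 ^ N : ℝ) ≠ 0 := by positivity
  field_simp at h
  linarith

/-- Cauchy–Schwarz with binomial weights: the mean absolute deviation is at most the standard
deviation. -/
lemma sum_choose_mul_abs_le (N : ℕ) :
    ∑ j ∈ Finset.range (N + 1), (N.choose j : ℝ) * |2 * (j : ℝ) - N| ≤ √N * 2 ^ N := by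
  have hcs := Finset.sum_mul_sq_le_sq_mul_sq (Finset.range (N + 1))
    (fun j => √(N.choose j : ℝ)) (fun j => √(N.choose j : ℝ) * |2 * (j : ℝ) - N|)
  have e1 : ∀ j : ℕ, √(N.choose j : ℝ) * (√(N.choose j : ℝ) * |2 * (j : ℝ) - N|)
      = (N.choose j : ℝ) * |2 * (j : ℝ) - N| := fun j => by
    rw [← mul_assoc, Real.mul_self_sqrt (Nat.cast_nonneg _)]
  have e2 : ∀ j : ℕ, (√(N.choose j : ℝ) * |2 * (j : ℝ) - N|) ^ 2
      = (N.choose j : ℝ) * (2 * (j : ℝ) - N) ^ 2 := fun j => by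
    rw [mul_pow, Real.sq_sqrt (Nat.cast_nonneg _), sq_abs]
  simp only [e1, e2, Real.sq_sqrt (Nat.cast_nonneg (α := ℝ) _)] at hcs
  rw [sum_choose_mul_sq] at hcs
  have h2 : ∑ j ∈ Finset.range (N + 1), (N.choose j : ℝ) = 2 ^ N := by
    exact_mod_cast Nat.sum_range_choose N
  rw [h2] at hcs
  refine abs_le_of_sq_le_sq' ?_ (by positivity) |>.2
  rw [mul_pow, Real.sq_sqrt (Nat.cast_nonneg _)]
  calc _ ≤ _ := hcs
    _ = _ := by ring

lemma norm_pow_le_one_of_norm_le_one {A : Type*} [NormedRing A] [NormOneClass A] {U : A} (hU : ‖U‖ ≤ 1) (k : ℕ) :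
    ‖U ^ k‖ ≤ 1 :=
  (norm_pow_le U k).trans (pow_le_one₀ (norm_nonneg _) hU)

variable {A : Type*} [NormedRing A] [NormedAlgebra ℝ A]

/-- The coefficients of `(U - 1) (1 + U) ^ k` are differences of adjacent binomials, proportional to
the deviation of `j` from the mean. The `j`-weighted sum is `U` times the derivative of `(1 + U) ^
(k + 1)`. -/
lemma natCast_smul_sub_one_mul_one_add_pow (U : A) (k : ℕ) :
    ((k + 1 : ℕ) : ℝ) • ((U - 1) * (1 + U) ^ k) =
      ∑ j ∈ Finset.range (k + 1 + 1),
        (((k + 1).choose j : ℝ) * (2 * j - (k + 1 : ℕ))) • U ^ j := by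
  have hb : ∀ N : ℕ, (1 + U) ^ N = ∑ j ∈ Finset.range (N + 1), (N.choose j : ℝ) • U ^ j := by
    intro N
    rw [add_comm, (Commute.one_right U).add_pow]
    refine Finset.sum_congr rfl fun j _ => ?_
    rw [one_pow, mul_one, ← Nat.cast_comm, ← nsmul_eq_mul, Nat.cast_smul_eq_nsmul]
  have hd : ∑ j ∈ Finset.range (k + 1 + 1), (((k + 1).choose j : ℝ) * j) • U ^ j
      = ((k + 1 : ℕ) : ℝ) • (U * (1 + U) ^ k) := by
    rw [Finset.sum_range_succ', hb, Finset.mul_sum, Finset.smul_sum]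
    simp only [Nat.cast_zero, mul_zero, zero_smul, add_zero]
    refine Finset.sum_congr rfl fun j _ => ?_
    rw [mul_smul_comm, ← pow_succ', smul_smul]
    congr 1
    have := Nat.add_one_mul_choose_eq k j
    exact_mod_cast this.symm
  have hs : ∀ j : ℕ, (((k + 1).choose j : ℝ) * (2 * j - (k + 1 : ℕ))) • U ^ j
      = (2 : ℝ) • ((((k + 1).choose j : ℝ) * j) • U ^ j)
        - ((k + 1 : ℕ) : ℝ) • (((k + 1).choose j : ℝ) • U ^ j) := fun j => by
    rw [smul_smul, smul_smul, ← sub_smul]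
    congr 1
    ring
  simp only [hs]
  rw [Finset.sum_sub_distrib, ← Finset.smul_sum, ← Finset.smul_sum, hd, ← hb, smul_comm,
    ← smul_sub]
  congr 1
  rw [two_smul, pow_succ', sub_mul, add_mul, one_mul]
  abel

lemma norm_sub_one_mul_one_add_pow_le [NormOneClass A] {U : A} (hU : ‖U‖ ≤ 1) (k : ℕ) :
    ‖(U - 1) * (1 + U) ^ k‖ ≤ 2 * 2 ^ k / √(k + 1) := by
  have h1 : ((k + 1 : ℕ) : ℝ) * ‖(U - 1) * (1 + U) ^ k‖ ≤ √(k + 1 : ℕ) * 2 ^ (k + 1) := by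
    have : ((k + 1 : ℕ) : ℝ) * ‖(U - 1) * (1 + U) ^ k‖
        = ‖((k + 1 : ℕ) : ℝ) • ((U - 1) * (1 + U) ^ k)‖ := by
      rw [norm_smul, Real.norm_natCast]
    rw [this, natCast_smul_sub_one_mul_one_add_pow]
    refine (norm_sum_le _ _).trans (le_trans (Finset.sum_le_sum fun j _ => ?_)
      (sum_choose_mul_abs_le (k + 1)))
    rw [norm_smul, norm_mul, Real.norm_natCast, Real.norm_eq_abs]
    exact mul_le_of_le_one_right (by positivity) (norm_pow_le_one_of_norm_le_one hU j)
  push_cast at h1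
  have hs : 0 < √((k : ℝ) + 1) := by positivity
  rw [le_div_iff₀ hs]
  have h2 : √((k : ℝ) + 1) * √((k : ℝ) + 1) = k + 1 := Real.mul_self_sqrt (by positivity)
  refine le_of_mul_le_mul_left ?_ hs
  calc _ = ((k : ℝ) + 1) * ‖(U - 1) * (1 + U) ^ k‖ := by rw [← mul_assoc, mul_right_comm, h2]
    _ ≤ _ := h1
    _ = _ := by ring

/-- The second difference of the `k`-step lazy walk with steps `U`, `V = U⁻¹`. -/
lemma norm_add_sub_two_mul_pow_le [NormOneClass A] {U V : A} (hU : ‖U‖ ≤ 1) (hV : ‖V‖ ≤ 1)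
    (hUV : U * V = 1) (hVU : V * U = 1) (k : ℕ) :
    ‖(U + V - 2) * ((1 / 4 : ℝ) • (U + V + 2)) ^ k‖ ≤ 4 / (k + 1) := by
  have hc : Commute U V := by rw [Commute, SemiconjBy, hUV, hVU]
  have hc' : Commute (1 + U) (1 + V) :=
    ((Commute.one_left _).add_left ((Commute.one_right U).add_right hc))
  -- As `V` inverts `U`, both the walk and its second difference factor into a `U`-part and a
  -- `V`-part; each part contributes a factor of order `1/√(k+1)`.
  have e1 : U + V + 2 = (1 + U) * (1 + V) := by
    rw [add_mul, mul_add, mul_add, hUV, one_mul, one_mul, mul_one, ← one_add_one_eq_two]; abel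
  have e2 : U + V - 2 = -((U - 1) * (V - 1)) := by
    rw [sub_mul, mul_sub, mul_sub, hUV, one_mul, one_mul, mul_one, ← one_add_one_eq_two]; abel
  have hc2 : Commute (V - 1) ((1 + U) ^ k) :=
    ((Commute.one_right _).add_right (hc.symm.sub_left (Commute.one_left U))).pow_right k
  have e3 : (U + V - 2) * ((1 / 4 : ℝ) • (U + V + 2)) ^ k
      = -((1 / 4 : ℝ) ^ k • (((U - 1) * (1 + U) ^ k) * ((V - 1) * (1 + V) ^ k))) := by
    rw [e1, e2, smul_pow, hc'.mul_pow, mul_smul_comm, ← smul_neg, neg_mul]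
    congr 2
    rw [mul_assoc, ← mul_assoc (V - 1), hc2.eq]
    simp only [mul_assoc]
  rw [e3, norm_neg, norm_smul]
  have hs : √((k : ℝ) + 1) * √((k : ℝ) + 1) = k + 1 := Real.mul_self_sqrt (by positivity)
  have h4 : ‖(1 / 4 : ℝ) ^ k‖ = (1 / 4 : ℝ) ^ k := by
    rw [Real.norm_eq_abs, abs_of_nonneg (by positivity)]
  rw [h4]
  calc _ ≤ (1 / 4 : ℝ) ^ k * ((2 * 2 ^ k / √(k + 1)) * (2 * 2 ^ k / √(k + 1))) := by
        gcongr
        exact (norm_mul_le _ _).trans (mul_le_mul (norm_sub_one_mul_one_add_pow_le hU k)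
          (norm_sub_one_mul_one_add_pow_le hV k) (norm_nonneg _) (by positivity))
    _ = (1 / 4 : ℝ) ^ k * (2 ^ k * 2 ^ k) * (4 / (√(k + 1) * √(k + 1))) := by
        field_simp; ring
    _ = _ := by
        rw [hs, ← mul_pow, ← mul_pow]; norm_num

/-- The mean of `1/(K+1)` for a binomial `K`: absorbing `k + 1` into the binomial coefficient yields
the expansion of `(c + (1 - c)) ^ (m + 1)` without its zeroth term. -/
lemma sum_choose_div_succ_le {c : ℝ} (hc : 0 < c) (hc1 : c ≤ 1) (m : ℕ) :
    ∑ k ∈ Finset.range (m + 1), c ^ k * (1 - c) ^ (m - k) * (m.choose k) * (4 / ((k : ℝ) + 1))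
      ≤ 4 / (c * (m + 1)) := by
  have h := add_pow c (1 - c) (m + 1)
  rw [Finset.sum_range_succ'] at h
  have h0 : (0 : ℝ) ≤ c ^ 0 * (1 - c) ^ (m + 1 - 0) * ((m + 1).choose 0) := by
    have : 0 ≤ 1 - c := by linarith
    positivity
  simp only [add_sub_cancel, one_pow, Nat.add_sub_add_right] at h
  rw [le_div_iff₀ (by positivity), Finset.sum_mul]
  have : ∀ k ∈ Finset.range (m + 1),
      c ^ k * (1 - c) ^ (m - k) * (m.choose k) * (4 / ((k : ℝ) + 1)) * (c * (m + 1))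
      = 4 * (c ^ (k + 1) * (1 - c) ^ (m - k) * ((m + 1).choose (k + 1))) := by
    intro k _
    have e : ((m : ℝ) + 1) * m.choose k = (m + 1).choose (k + 1) * (k + 1) := by
      exact_mod_cast Nat.add_one_mul_choose_eq m k
    have hk : (k : ℝ) + 1 ≠ 0 := by positivity
    field_simp
    rw [pow_succ]
    linear_combination (c ^ k * (1 - c) ^ (m - k) * c) * e
  rw [Finset.sum_congr rfl this, ← Finset.mul_sum]
  linarith

/-- Smoothing of second differences by the powers of `F = c L + R`, where `L` is a lazy walk and
`R` is a remainder of norm at most `1 - c`. -/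
lemma norm_second_difference_mul_pow_le [NormOneClass A] {U V R : A} (hU : ‖U‖ ≤ 1)
    (hV : ‖V‖ ≤ 1) (hUV : U * V = 1) (hVU : V * U = 1) {c : ℝ} (hc : 0 < c) (hc1 : c ≤ 1)
    (hR : ‖R‖ ≤ 1 - c) (hRU : Commute R U) (hRV : Commute R V) (m : ℕ) :
    ‖(U + V - 2) * (c • ((1 / 4 : ℝ) • (U + V + 2)) + R) ^ m‖ ≤ 4 / (c * (m + 1)) := by
  set L := (1 / 4 : ℝ) • (U + V + 2) with hL
  have hRL : Commute (c • L) R :=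
    ((((hRU.add_right hRV).add_right (Commute.ofNat_right R 2)).smul_right _).smul_right c).symm
  rw [hRL.add_pow, Finset.mul_sum]
  refine (norm_sum_le _ _).trans (le_trans (Finset.sum_le_sum fun k _ => ?_)
    (sum_choose_div_succ_le hc hc1 m))
  have e : (U + V - 2) * ((c • L) ^ k * R ^ (m - k) * (m.choose k : A))
      = (c ^ k * (m.choose k : ℝ)) • (((U + V - 2) * L ^ k) * R ^ (m - k)) := by
    rw [← Nat.cast_comm, ← nsmul_eq_mul, ← Nat.cast_smul_eq_nsmul ℝ, smul_pow]
    simp only [mul_smul_comm, smul_mul_assoc, smul_smul, mul_assoc]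
    rw [mul_comm]
  rw [e, norm_smul, Real.norm_eq_abs, abs_of_nonneg (by positivity)]
  calc _ ≤ (c ^ k * (m.choose k : ℝ)) * ((4 / (k + 1)) * (1 - c) ^ (m - k)) := by
        gcongr
        refine (norm_mul_le _ _).trans (mul_le_mul (norm_add_sub_two_mul_pow_le hU hV hUV hVU k)
          ?_ (norm_nonneg _) (by positivity))
        exact (norm_pow_le _ _).trans (pow_le_pow_left₀ (norm_nonneg _) hR _)
    _ = _ := by ring

end Smoothing

/-! ### Absolutely convergent combinations of a bounded representation -/

section Representation

lemma summable_norm_smul_of_norm_le_one {G A : Type*} [SeminormedAddCommGroup A]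
    [NormedSpace ℝ A] {U : G → A} {p : G → ℝ} (hU : ∀ x, ‖U x‖ ≤ 1) (hp : Summable fun x => |p x|) :
    Summable fun x => ‖p x • U x‖ := by
  refine hp.of_nonneg_of_le (fun _ => norm_nonneg _) fun x => ?_
  rw [norm_smul, Real.norm_eq_abs]
  exact mul_le_of_le_one_right (abs_nonneg _) (hU x)

lemma norm_tsum_smul_le {G A : Type*} [SeminormedAddCommGroup A]
    [NormedSpace ℝ A] {U : G → A} {p : G → ℝ} (hU : ∀ x, ‖U x‖ ≤ 1) (hp : Summable fun x => |p x|) :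
    ‖∑' x, p x • U x‖ ≤ ∑' x, |p x| := by
  refine tsum_of_norm_bounded hp.hasSum fun x => ?_
  rw [norm_smul, Real.norm_eq_abs]
  exact mul_le_of_le_one_right (abs_nonneg _) (hU x)

variable {G : Type*} [AddCommGroup G] {A : Type*} [NormedRing A] [NormedAlgebra ℝ A]
  [CompleteSpace A] {U : G → A} {p : G → ℝ}

lemma commute_tsum_smul (hadd : ∀ x y, U (x + y) = U x * U y) (hU : ∀ x, ‖U x‖ ≤ 1)
    (hp : Summable fun x => |p x|) (y : G) : Commute (∑' x, p x • U x) (U y) := by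
  have hs := (summable_norm_smul_of_norm_le_one hU hp).of_norm
  rw [Commute, SemiconjBy, ← hs.tsum_mul_right, ← hs.tsum_mul_left]
  refine tsum_congr fun x => ?_
  rw [smul_mul_assoc, mul_smul_comm, ← hadd, ← hadd, add_comm]

/-- Mass `2t` at `0` and `t` at each of `x`, `-x` is removed from `p`, where `t` is the largest
value keeping the rest nonnegative. The removed part is `4t` times the lazy walk, and what is left
has norm at most `1 - 4t`. -/
lemma mul_norm_second_difference_mul_pow_le [NormOneClass A]
    (h0 : U 0 = 1) (hadd : ∀ x y, U (x + y) = U x * U y) (hU : ∀ x, ‖U x‖ ≤ 1)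
    (hp0 : ∀ x, 0 ≤ p x) (hp1 : HasSum p 1) (hneg : ∀ x, p (-x) = p x) (hq : 0 < p 0)
    {x : G} (hx : x ≠ 0) (hxx : x ≠ -x) (m : ℕ) :
    p x * ‖(U x + U (-x) - 2) * (∑' y, p y • U y) ^ m‖ ≤ 1 / (p 0 * (m + 1)) := by
  classical
  have hq1 : p 0 ≤ 1 := le_hasSum hp1 0 fun y _ => hp0 y
  rcases (hp0 x).eq_or_lt with hpx | hpx
  · rw [← hpx, zero_mul]; positivity
  have hxn : -x ≠ 0 := neg_ne_zero.2 hx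
  have hp2 : p x ≤ 1 / 2 := by
    have h := sum_le_hasSum {x, -x} (fun y _ => hp0 y) hp1
    rw [Finset.sum_pair hxx, hneg] at h
    linarith
  set t := min (p 0 / 2) (p x) with ht
  have ht0 : 0 < t := lt_min (by linarith) hpx
  have htq : t ≤ p 0 / 2 := min_le_left _ _
  have htp : t ≤ p x := min_le_right _ _
  set w : G → ℝ := fun y => p y - (if y = 0 then 2 * t else 0) - (if y = x then t else 0)
    - (if y = -x then t else 0) with hw
  have hw0 : ∀ y, 0 ≤ w y := by
    intro y
    simp only [hw]
    by_cases h1 : y = 0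
    · subst h1
      simp [hx.symm, hxn.symm]; linarith
    · by_cases h2 : y = x
      · subst h2; simp [h1, hxx, htp]
      · by_cases h3 : y = -x
        · subst h3; simp [h1, h2, hneg, htp]
        · simp [h1, h2, h3, hp0 y]
  have hwsum : HasSum w (1 - 2 * t - t - t) :=
    ((hp1.sub (hasSum_ite_eq 0 (2 * t))).sub (hasSum_ite_eq x t)).sub (hasSum_ite_eq (-x) t)
  have hwabs : (fun y => |w y|) = w := funext fun y => abs_of_nonneg (hw0 y)
  have hwS : Summable fun y => |w y| := by rw [hwabs]; exact hwsum.summable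
  have hpS : Summable fun y => |p y| := by
    simpa only [abs_of_nonneg (hp0 _)] using hp1.summable
  set R := ∑' y, w y • U y with hR
  have hRn : ‖R‖ ≤ 1 - 4 * t := by
    refine (norm_tsum_smul_le hU hwS).trans ?_
    rw [hwabs, hwsum.tsum_eq]
    linarith
  have hF : ∑' y, p y • U y = (4 * t) • ((1 / 4 : ℝ) • (U x + U (-x) + 2)) + R := by
    have hs : ∀ (z : G) (a : ℝ), HasSum (fun y => (if y = z then a else 0) • U y) (a • U z) := by
      intro z a
      convert hasSum_ite_eq z (a • U z) using 2 with y
      split_ifs with h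
      · rw [h]
      · rw [zero_smul]
    have h1 : HasSum (fun y => w y • U y)
        ((∑' y, p y • U y) - (2 * t) • U 0 - t • U x - t • U (-x)) := by
      simp only [hw, sub_smul]
      exact ((((summable_norm_smul_of_norm_le_one hU hpS).of_norm.hasSum.sub
        (hs 0 (2 * t))).sub (hs x t)).sub (hs (-x) t))
    rw [hR, h1.tsum_eq, h0, ← one_add_one_eq_two (R := A)]
    module
  have hkey := norm_second_difference_mul_pow_le (hU x) (hU (-x))
    (by rw [← hadd, add_neg_cancel, h0]) (by rw [← hadd, neg_add_cancel, h0])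
    (c := 4 * t) (by positivity) (by linarith [norm_nonneg R]) hRn
    (commute_tsum_smul hadd hU hwS x) (commute_tsum_smul hadd hU hwS (-x)) m
  rw [hF]
  calc _ ≤ p x * (4 / (4 * t * (m + 1))) := by gcongr
    _ = p x / (t * (m + 1)) := by field_simp
    _ ≤ 1 / (p 0 * (m + 1)) := by
      rw [div_le_div_iff₀ (by positivity) (by positivity)]
      -- The two cases use `p x ≤ 1/2`, from the distinct equal atoms at `x` and `-x`, and `p 0 ≤
      -- 1`.
      have : p x * p 0 ≤ t := le_min (by nlinarith) (by nlinarith)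
      have hm : (0 : ℝ) ≤ m + 1 := by positivity
      nlinarith

/-- Pairing `x` with `-x` turns `F - 1` into second differences. Each is bounded either trivially by
`4 p x` or by smoothing, according to which entry of the minimum is smaller. Torsion-freeness
separates `x` from `-x`. -/
lemma norm_sub_one_mul_pow_le [NormOneClass A] [IsAddTorsionFree G]
    (h0 : U 0 = 1) (hadd : ∀ x y, U (x + y) = U x * U y) (hU : ∀ x, ‖U x‖ ≤ 1)
    (hp0 : ∀ x, 0 ≤ p x) (hp1 : HasSum p 1) (hneg : ∀ x, p (-x) = p x) (hq : 0 < p 0)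
    {n : ℕ} (hn : 1 ≤ n) (k : ℕ) :
    ‖((∑' y, p y • U y) - 1) * (∑' y, p y • U y) ^ k‖ ≤
      2 * (1 + n / (k + 1)) * ∑' x : {x : G // x ≠ 0}, min (p x) (1 / (n * p 0)) := by
  have hpS : Summable fun y => |p y| := by
    simpa only [abs_of_nonneg (hp0 _)] using hp1.summable
  set F := ∑' y, p y • U y with hF
  have hFs : HasSum (fun y => p y • U y) F :=
    (summable_norm_smul_of_norm_le_one hU hpS).of_norm.hasSum
  have hFn : ‖F‖ ≤ 1 := by
    refine (norm_tsum_smul_le hU hpS).trans ?_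
    simp only [abs_of_nonneg (hp0 _), hp1.tsum_eq, le_refl]
  have hn0 : (0 : ℝ) < n := by exact_mod_cast hn
  set g : G → ℝ := Set.indicator {x | x ≠ 0} fun x => min (p x) (1 / (n * p 0)) with hg
  have hgsub : ∑' x : {x : G // x ≠ 0}, min (p x) (1 / (n * p 0)) = ∑' x, g x :=
    tsum_subtype {x : G | x ≠ 0} fun x => min (p x) (1 / (n * p 0))
  have hgp : ∀ x, 0 ≤ g x := fun x => Set.indicator_nonneg
    (fun y _ => le_min (hp0 y) (by positivity)) x
  have hgS : Summable g := hp1.summable.of_nonneg_of_le hgp fun x =>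
    Set.indicator_le' (fun y _ => min_le_left _ _) (fun y _ => hp0 y) x
  have hFs' : HasSum (fun y => p y • U (-y)) F := by
    have := (Equiv.neg G).hasSum_iff.2 hFs
    simpa only [Function.comp_def, Equiv.neg_apply, hneg] using this
  have h1 : HasSum (fun y => p y • (1 : A)) ((1 : ℝ) • (1 : A)) := hp1.smul_const 1
  have hsum : HasSum (fun y => p y • ((U y + U (-y) - 2) * F ^ k)) ((2 : ℝ) • ((F - 1) * F ^ k)) := by
    have := (((hFs.add hFs').sub (h1.add h1)).mul_right (F ^ k))
    have e1 : ∀ y, p y • ((U y + U (-y) - 2) * F ^ k)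
        = (p y • U y + p y • U (-y) - (p y • (1 : A) + p y • (1 : A))) * F ^ k := fun y => by
      rw [← one_add_one_eq_two (R := A), ← smul_add, ← smul_add, ← smul_sub, smul_mul_assoc]
    have e2 : (2 : ℝ) • ((F - 1) * F ^ k)
        = (F + F - ((1 : ℝ) • (1 : A) + (1 : ℝ) • (1 : A))) * F ^ k := by
      rw [one_smul, two_smul, ← add_mul]; congr 1; abel
    simp only [e1]
    rw [e2]
    exact this
  have hterm : ∀ y, ‖p y • ((U y + U (-y) - 2) * F ^ k)‖ ≤ 4 * (1 + n / (k + 1)) * g y := by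
    intro y
    by_cases hy : y = 0
    · subst hy
      rw [neg_zero, h0, one_add_one_eq_two, sub_self, zero_mul, smul_zero, norm_zero]
      have := hgp 0
      positivity
    rw [norm_smul, Real.norm_eq_abs, abs_of_nonneg (hp0 y)]
    have hgy : g y = min (p y) (1 / (n * p 0)) := Set.indicator_of_mem (by exact hy) _
    have ha : p y * ‖(U y + U (-y) - 2) * F ^ k‖ ≤ 4 * p y := by
      rw [mul_comm]
      refine mul_le_mul_of_nonneg_right ?_ (hp0 y)
      have h3 : ‖U y + U (-y) - 2‖ ≤ 4 := by
        have h2 : ‖(2 : A)‖ ≤ 2 := by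
          rw [← one_add_one_eq_two]
          refine (norm_add_le _ _).trans ?_
          rw [norm_one]; norm_num
        refine (norm_sub_le _ _).trans ?_
        linarith [norm_add_le (U y) (U (-y)), hU y, hU (-y)]
      calc _ ≤ ‖U y + U (-y) - 2‖ * ‖F ^ k‖ := norm_mul_le _ _
        _ ≤ 4 * 1 := mul_le_mul h3 (norm_pow_le_one_of_norm_le_one hFn k) (norm_nonneg _)
          (by norm_num)
        _ = 4 := mul_one 4
    have hb := mul_norm_second_difference_mul_pow_le h0 hadd hU hp0 hp1 hneg hq hy
      (fun h => hy (self_eq_neg.1 h)) k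
    rw [hgy]
    have hk : (0 : ℝ) ≤ n / (k + 1) := by positivity
    rcases min_choice (p y) (1 / (n * p 0)) with h | h
    · rw [h]
      nlinarith [hp0 y, mul_nonneg hk (hp0 y)]
    · rw [h]
      refine hb.trans ?_
      have e : 1 / (p 0 * ((k : ℝ) + 1)) = n / (k + 1) * (1 / (n * p 0)) := by field_simp
      rw [e]
      have : 0 ≤ 1 / (n * p 0) := by positivity
      nlinarith [mul_nonneg hk this]
  have hfin := tsum_of_norm_bounded (hgS.hasSum.mul_left (4 * (1 + (n : ℝ) / (k + 1)))) hterm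
  rw [hsum.tsum_eq, norm_smul, Real.norm_ofNat] at hfin
  rw [hgsub]
  linarith

end Representation

/-! ### Powers and exponentials near the identity in a Banach algebra -/

section PowerExp

/-- Each of the `r` factors `a` receives `l` of the powers of `B`; the surplus powers are
contractions. -/
lemma norm_pow_mul_pow_le {A : Type*} [NormedRing A] [NormOneClass A] {a B : A} (hc : Commute a B) (hB : ‖B‖ ≤ 1) {ρ : ℝ}
    {r l j : ℕ} (hj : r * l ≤ j) (h : ‖a * B ^ l‖ ≤ ρ) : ‖a ^ r * B ^ j‖ ≤ ρ ^ r := by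
  have e : a ^ r * B ^ j = (a * B ^ l) ^ r * B ^ (j - r * l) := by
    rw [(hc.pow_right l).mul_pow, ← pow_mul, mul_assoc, ← pow_add, mul_comm l r,
      Nat.add_sub_cancel' hj]
  rw [e]
  calc _ ≤ ‖(a * B ^ l) ^ r‖ * ‖B ^ (j - r * l)‖ := norm_mul_le _ _
    _ ≤ ρ ^ r * 1 := mul_le_mul ((norm_pow_le _ _).trans
        (pow_le_pow_left₀ (norm_nonneg _) h r)) (norm_pow_le_one_of_norm_le_one hB _)
        (norm_nonneg _) (pow_nonneg ((norm_nonneg _).trans h) r)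
    _ = _ := mul_one _

variable {A : Type*} [NormedRing A] [NormedAlgebra ℝ A] [CompleteSpace A]

lemma sum_poisson_le {l α β : ℝ} (hl : 0 ≤ l) (hβ : 0 ≤ β) :
    Summable (fun k : ℕ => (k.factorial : ℝ)⁻¹ * l ^ k * (α + β / (k + 1))) ∧
    ∑' k : ℕ, (k.factorial : ℝ)⁻¹ * l ^ k * (α + β / (k + 1))
      ≤ Real.exp l * (α + 2 * β / (l + 1)) := by
  have hE : HasSum (fun k : ℕ => l ^ k / (k.factorial : ℝ)) (Real.exp l) := by
    rw [Real.exp_eq_exp_ℝ]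
    exact NormedSpace.expSeries_div_hasSum_exp l
  have hE1 : HasSum (fun k : ℕ => l ^ (k + 1) / ((k + 1).factorial : ℝ)) (Real.exp l - 1) := by
    have := (hasSum_nat_add_iff' (f := fun k : ℕ => l ^ k / (k.factorial : ℝ)) 1).2 hE
    simpa using this
  have hfac : ∀ k : ℕ, ((k + 1).factorial : ℝ) = ((k : ℝ) + 1) * k.factorial := fun k => by
    rw [Nat.factorial_succ]; push_cast; ring
  have hS : Summable (fun k : ℕ => l ^ k / ((k + 1).factorial : ℝ)) := by
    refine hE.summable.of_nonneg_of_le (fun k => by positivity) fun k => ?_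
    gcongr
    exact Nat.le_succ k
  -- `l` times the series is `exp l - 1`, and the series itself is at most `exp l`. Using `l + 1` in
  -- place of `l` keeps the bound valid at `l = 0`.
  have hSle : (l + 1) * ∑' k : ℕ, l ^ k / ((k + 1).factorial : ℝ) ≤ 2 * Real.exp l := by
    have h1 : l * ∑' k : ℕ, l ^ k / ((k + 1).factorial : ℝ) = Real.exp l - 1 := by
      rw [← tsum_mul_left, ← hE1.tsum_eq]
      refine tsum_congr fun k => ?_
      rw [pow_succ]; ring
    have h2 : ∑' k : ℕ, l ^ k / ((k + 1).factorial : ℝ) ≤ Real.exp l := by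
      rw [← hE.tsum_eq]
      refine hS.tsum_le_tsum (fun k => ?_) hE.summable
      gcongr
      exact Nat.le_succ k
    linarith
  have e : ∀ k : ℕ, (k.factorial : ℝ)⁻¹ * l ^ k * (α + β / (k + 1))
      = α * (l ^ k / (k.factorial : ℝ)) + β * (l ^ k / ((k + 1).factorial : ℝ)) := fun k => by
    rw [hfac]; field_simp
  have hsum := (hE.mul_left α).add (hS.hasSum.mul_left β)
  simp only [e]
  refine ⟨hsum.summable, ?_⟩
  rw [hsum.tsum_eq]
  have : β * ∑' k : ℕ, l ^ k / ((k + 1).factorial : ℝ) ≤ β * (2 * Real.exp l / (l + 1)) := by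
    gcongr
    rw [le_div_iff₀ (by positivity)]
    linarith
  calc _ ≤ α * Real.exp l + β * (2 * Real.exp l / (l + 1)) := by linarith
    _ = _ := by field_simp

/-- The exponential of `l (F - 1)` is the Poisson average of the powers of `F`. -/
lemma norm_mul_exp_smul_sub_one_le {a F : A} {l α β : ℝ} (hl : 0 ≤ l) (hβ : 0 ≤ β)
    (h : ∀ k : ℕ, ‖a * F ^ k‖ ≤ α + β / (k + 1)) :
    ‖a * NormedSpace.exp (l • (F - 1))‖ ≤ α + 2 * β / (l + 1) := by
  let _ := NormedAlgebra.restrictScalars ℚ ℝ A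
  have h1 : NormedSpace.exp (l • (F - 1)) = Real.exp (-l) • NormedSpace.exp (l • F) := by
    have e : l • (F - 1) = algebraMap ℝ A (-l) + l • F := by
      rw [Algebra.algebraMap_eq_smul_one, smul_sub, neg_smul]; abel
    rw [e, NormedSpace.exp_add_of_commute (Algebra.commutes _ _),
      ← NormedSpace.algebraMap_exp_comm, ← Algebra.smul_def, Real.exp_eq_exp_ℝ]
  have h2 : HasSum (fun k : ℕ => (k.factorial : ℝ)⁻¹ • (l • F) ^ k) (NormedSpace.exp (l • F)) :=
    NormedSpace.exp_series_hasSum_exp' (𝕂 := ℝ) _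
  have h3 := h2.mul_left a
  obtain ⟨hs, hle⟩ := sum_poisson_le (α := α) hl hβ
  have h4 : ‖a * NormedSpace.exp (l • F)‖ ≤ Real.exp l * (α + 2 * β / (l + 1)) := by
    rw [← h3.tsum_eq]
    refine (tsum_of_norm_bounded hs.hasSum fun k => ?_).trans hle
    rw [smul_pow, smul_smul, mul_smul_comm, norm_smul, Real.norm_eq_abs,
      abs_of_nonneg (by positivity)]
    gcongr
    exact h k
  rw [h1, mul_smul_comm, norm_smul, Real.norm_eq_abs, abs_of_pos (Real.exp_pos _)]
  calc _ ≤ Real.exp (-l) * (Real.exp l * (α + 2 * β / (l + 1))) := by gcongr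
    _ = _ := by rw [← mul_assoc, ← Real.exp_add]; simp

lemma norm_exp_smul_sub_one_le [NormOneClass A] {F : A} (hF : ‖F‖ ≤ 1) {l : ℝ} (hl : 0 ≤ l) :
    ‖NormedSpace.exp (l • (F - 1))‖ ≤ 1 := by
  simpa using norm_mul_exp_smul_sub_one_le (a := (1 : A)) (F := F) (α := 1) hl le_rfl
    fun k => by simpa using norm_pow_le_one_of_norm_le_one hF k

/-- Taylor remainder of the exponential, factored. -/
lemma exists_exp_eq_sum_add_pow_mul [NormOneClass A] (x : A) (k : ℕ) :
    ∃ R : A, ‖R‖ ≤ Real.exp ‖x‖ ∧ (∀ y, Commute x y → Commute R y) ∧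
      NormedSpace.exp x = ∑ i ∈ Finset.range k, ((i.factorial : ℝ)⁻¹) • x ^ i + R * x ^ k := by
  have hE : HasSum (fun j : ℕ => ‖x‖ ^ j / (j.factorial : ℝ)) (Real.exp ‖x‖) := by
    rw [Real.exp_eq_exp_ℝ]
    exact NormedSpace.expSeries_div_hasSum_exp ‖x‖
  have hb : ∀ j : ℕ, ‖(((j + k).factorial : ℝ)⁻¹) • x ^ j‖ ≤ ‖x‖ ^ j / (j.factorial : ℝ) := by
    intro j
    rw [norm_smul, Real.norm_eq_abs, abs_of_nonneg (by positivity), div_eq_inv_mul]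
    gcongr
    · exact Nat.le_add_right j k
    · exact norm_pow_le x j
  have hS : Summable fun j : ℕ => (((j + k).factorial : ℝ)⁻¹) • x ^ j :=
    Summable.of_norm_bounded hE.summable hb
  refine ⟨∑' j : ℕ, (((j + k).factorial : ℝ)⁻¹) • x ^ j, tsum_of_norm_bounded hE hb,
    fun y hy => Commute.tsum_left y fun j => (hy.pow_left j).smul_left _, ?_⟩
  have h := NormedSpace.exp_series_hasSum_exp' (𝕂 := ℝ) x
  rw [← h.tsum_eq, ← h.summable.sum_add_tsum_nat_add k, ← hS.tsum_mul_right]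
  simp only [smul_mul_assoc, ← pow_add]

/-- Second-order telescoping of a difference of powers. -/
lemma pow_sub_pow_sub_eq_sum {R : Type*} [Ring R] {x y : R} (h : Commute x y) (n : ℕ) :
    x ^ n - y ^ n - (n : R) * ((x - y) * y ^ (n - 1)) =
      ∑ i ∈ Finset.range n, ∑ j ∈ Finset.range i,
        (x - y) ^ 2 * (x ^ j * y ^ (i - 1 - j + (n - 1 - i))) := by
  have h1 : (n : R) * ((x - y) * y ^ (n - 1))
      = (x - y) * ∑ i ∈ Finset.range n, y ^ i * y ^ (n - 1 - i) := by
    have : ∀ i ∈ Finset.range n, y ^ i * y ^ (n - 1 - i) = y ^ (n - 1) := by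
      intro i hi
      rw [Finset.mem_range] at hi
      rw [← pow_add]; congr 1; omega
    rw [Finset.sum_congr rfl this, Finset.sum_const, Finset.card_range, nsmul_eq_mul,
      ← mul_assoc, ← mul_assoc, Nat.cast_comm]
  -- The first-order telescoping is used here for exponent `n`, and then again for each difference
  -- `x ^ i - y ^ i` inside the sum.
  rw [h1, ← h.mul_geom_sum₂ n, ← mul_sub, ← Finset.sum_sub_distrib, Finset.mul_sum]
  refine Finset.sum_congr rfl fun i _ => ?_
  rw [← sub_mul, ← h.mul_geom_sum₂ i, mul_assoc, ← mul_assoc, ← sq, Finset.sum_mul,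
    Finset.mul_sum]
  refine Finset.sum_congr rfl fun j _ => ?_
  rw [pow_add, mul_assoc]

/-- The second-order compound Poisson expansion of a power of a contraction `F` whose powers are
smoothing: `‖(F - 1) F ^ k‖` decays like `1 / (k + 1)` up to the scale `n`. -/
lemma norm_pow_sub_exp_mul_le [NormOneClass A] {F : A} (hF : ‖F‖ ≤ 1) {n : ℕ} (hn : 1 ≤ n)
    {D : ℝ} (hD : 0 ≤ D)
    (h : ∀ k : ℕ, ‖(F - 1) * F ^ k‖ ≤ 2 * (1 + n / (k + 1)) * D) :
    ‖F ^ n - NormedSpace.exp ((n : ℝ) • (F - 1)) * (1 - ((n : ℝ) / 2) • (F - 1) ^ 2)‖ ≤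
      Real.exp 2 ^ 2 * 34 ^ 4 * (n * D ^ 3 + n ^ 2 * D ^ 4) := by
  let _ := NormedAlgebra.restrictScalars ℚ ℝ A
  set Φ := F - 1 with hΦ
  set T := NormedSpace.exp Φ with hT
  have hTn : ∀ l : ℕ, NormedSpace.exp ((l : ℝ) • Φ) = T ^ l := fun l => by
    rw [Nat.cast_smul_eq_nsmul, NormedSpace.exp_nsmul]
  have hΦn : ‖Φ‖ ≤ 2 := by
    refine (norm_sub_le _ _).trans ?_
    rw [norm_one]; linarith
  have hTl : ‖T‖ ≤ 1 := by
    have := norm_exp_smul_sub_one_le hF (l := 1) zero_le_one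
    rwa [one_smul] at this
  have hΦF : Commute Φ F := (Commute.refl F).sub_left (Commute.one_left F)
  have hΦT : Commute Φ T := (Commute.refl Φ).exp_right
  have hFT : Commute F T := hΦF.symm.exp_right
  have hn0 : (1 : ℝ) ≤ n := by exact_mod_cast hn
  -- The hypothesis gives `2 (1 + 8) = 18` for `F`, while the Poisson average for `T` gives `2 + 4 *
  -- 8 = 34`; the larger constant serves both.
  have hsF : ∀ l : ℕ, n ≤ 8 * (l + 1) → ‖Φ * F ^ l‖ ≤ 34 * D := by
    intro l hl
    refine (h l).trans ?_
    gcongr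
    have : (n : ℝ) / (l + 1) ≤ 8 := by
      rw [div_le_iff₀ (by positivity)]; exact_mod_cast hl
    linarith
  have hsT : ∀ l : ℕ, n ≤ 8 * (l + 1) → ‖Φ * T ^ l‖ ≤ 34 * D := by
    intro l hl
    have h1 := norm_mul_exp_smul_sub_one_le (a := Φ) (F := F) (l := l) (α := 2 * D)
      (β := 2 * n * D) (Nat.cast_nonneg _) (by positivity)
      fun k => (h k).trans_eq (by ring)
    rw [← hΦ, hTn] at h1
    refine h1.trans ?_
    have : (n : ℝ) / (l + 1) ≤ 8 := by
      rw [div_le_iff₀ (by positivity)]; exact_mod_cast hl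
    calc _ = 2 * D + 4 * (n / (l + 1)) * D := by ring
      _ ≤ 2 * D + 4 * 8 * D := by gcongr
      _ = _ := by ring
  obtain ⟨R1, hR1n, hR1c, hR1⟩ := exists_exp_eq_sum_add_pow_mul Φ 1
  obtain ⟨R2, hR2n, hR2c, hR2⟩ := exists_exp_eq_sum_add_pow_mul Φ 2
  obtain ⟨R3, hR3n, hR3c, hR3⟩ := exists_exp_eq_sum_add_pow_mul Φ 3
  have hexp : Real.exp ‖Φ‖ ≤ Real.exp 2 := Real.exp_le_exp.2 hΦn
  rw [← hT] at hR1 hR2 hR3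
  simp only [Finset.sum_range_succ, Finset.sum_range_zero, Nat.factorial_zero, Nat.factorial_one,
    Nat.factorial_two, pow_zero, pow_one, Nat.cast_one, Nat.cast_ofNat, inv_one, one_smul,
    zero_add] at hR1 hR2 hR3
  have hFΦ : F = 1 + Φ := by rw [hΦ]; abel
  have hd1 : F - T = -(R2 * Φ ^ 2) := by
    rw [hR2, hFΦ]; abel
  -- `F - T` begins with `-Φ²/2`, so adding `Φ² T / 2` leaves only third order. This is why the
  -- correction has coefficient `n/2`.
  have hd2 : (F - T) + (1 / 2 : ℝ) • (Φ ^ 2 * T) = ((1 / 2 : ℝ) • R1 - R3) * Φ ^ 3 := by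
    have e1 : Φ ^ 2 * T = Φ ^ 2 + R1 * Φ ^ 3 := by
      rw [(hΦT.pow_left 2).eq, hR1, add_mul, one_mul, mul_assoc, ← pow_succ']
    have e2 : F - T = -((1 / 2 : ℝ) • Φ ^ 2) - R3 * Φ ^ 3 := by
      rw [hR3, hFΦ, one_div]
      abel
    rw [e1, e2, sub_mul, smul_add, smul_mul_assoc]
    abel
  have hd3 : (F - T) ^ 2 = R2 ^ 2 * Φ ^ 4 := by
    rw [hd1, neg_sq, ((hR2c Φ (Commute.refl Φ)).pow_right 2).mul_pow, ← pow_mul]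
  -- The linear telescoping term `n (F - T) T ^ (n - 1)` merges with the correction to give the `Φ ^
  -- 3` term.
  have hmain : F ^ n - NormedSpace.exp ((n : ℝ) • Φ) * (1 - ((n : ℝ) / 2) • Φ ^ 2)
      = ∑ i ∈ Finset.range n, ∑ j ∈ Finset.range i,
          R2 ^ 2 * (Φ ^ 4 * (F ^ j * T ^ (i - 1 - j + (n - 1 - i))))
        + (n : ℝ) • (((1 / 2 : ℝ) • R1 - R3) * (Φ ^ 3 * T ^ (n - 1))) := by
    have e := pow_sub_pow_sub_eq_sum hFT n
    simp only [hd3, mul_assoc] at e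
    rw [← e, ← mul_assoc _ (Φ ^ 3), ← hd2, hTn]
    obtain ⟨m, rfl⟩ : ∃ m, n = m + 1 := ⟨n - 1, by omega⟩
    simp only [Nat.add_sub_cancel]
    have e3 : T ^ (m + 1) * Φ ^ 2 = Φ ^ 2 * T * T ^ m := by
      rw [mul_assoc, ← pow_succ', ((hΦT.pow_left 2).pow_right (m + 1)).eq]
    have e4 : ((m + 1 : ℕ) : A) * ((F - T) * T ^ m) = ((m + 1 : ℕ) : ℝ) • ((F - T) * T ^ m) := by
      rw [← nsmul_eq_mul, ← Nat.cast_smul_eq_nsmul ℝ]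
    rw [mul_sub, mul_one, mul_smul_comm, e3, add_mul, smul_add, e4, smul_mul_assoc, smul_smul,
      mul_one_div]
    abel
  have hterm : ∀ i ∈ Finset.range n, ∀ j ∈ Finset.range i,
      ‖R2 ^ 2 * (Φ ^ 4 * (F ^ j * T ^ (i - 1 - j + (n - 1 - i))))‖
        ≤ Real.exp 2 ^ 2 * (34 * D) ^ 4 := by
    intro i hi j hj
    rw [Finset.mem_range] at hi hj
    obtain ⟨r, hr⟩ : ∃ r, i - 1 - j + (n - 1 - i) = r := ⟨_, rfl⟩
    have hjr : j + r + 2 = n := by omega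
    rw [hr]
    refine (norm_mul_le _ _).trans (mul_le_mul ?_ ?_ (norm_nonneg _) (by positivity))
    · exact (norm_pow_le _ _).trans (pow_le_pow_left₀ (norm_nonneg _) (hR2n.trans hexp) 2)
    -- The larger of the two exponents is at least `(n - 2)/2`. Four equal shares of it, rounded
    -- down to `l`, still satisfy `n ≤ 8 (l + 1)`, whence the constant `8`.
    · rcases le_total r j with hc | hc
      · rw [← mul_assoc]
        refine (norm_mul_le _ _).trans ((mul_le_of_le_one_right (norm_nonneg _)
          (norm_pow_le_one_of_norm_le_one hTl r)).trans ?_)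
        exact norm_pow_mul_pow_le (l := j / 4) hΦF hF (by omega) (hsF _ (by omega))
      · rw [(hFT.pow_pow j r).eq, ← mul_assoc]
        refine (norm_mul_le _ _).trans ((mul_le_of_le_one_right (norm_nonneg _)
          (norm_pow_le_one_of_norm_le_one hF j)).trans ?_)
        exact norm_pow_mul_pow_le (l := r / 4) hΦT hTl (by omega) (hsT _ (by omega))
  have hfirst : ‖∑ i ∈ Finset.range n, ∑ j ∈ Finset.range i,
      R2 ^ 2 * (Φ ^ 4 * (F ^ j * T ^ (i - 1 - j + (n - 1 - i))))‖
      ≤ n ^ 2 * (Real.exp 2 ^ 2 * (34 * D) ^ 4) := by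
    have h1 : ∀ i ∈ Finset.range n, ‖∑ j ∈ Finset.range i,
        R2 ^ 2 * (Φ ^ 4 * (F ^ j * T ^ (i - 1 - j + (n - 1 - i))))‖
        ≤ n * (Real.exp 2 ^ 2 * (34 * D) ^ 4) := by
      intro i hi
      refine (norm_sum_le_of_le _ (hterm i hi)).trans ?_
      rw [Finset.sum_const, Finset.card_range, nsmul_eq_mul]
      have : i ≤ n := (Finset.mem_range.1 hi).le
      gcongr
    refine (norm_sum_le_of_le _ h1).trans ?_
    rw [Finset.sum_const, Finset.card_range, nsmul_eq_mul, sq (n : ℝ), mul_assoc]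
  have hsecond : ‖(n : ℝ) • (((1 / 2 : ℝ) • R1 - R3) * (Φ ^ 3 * T ^ (n - 1)))‖
      ≤ n * (2 * Real.exp 2 * (34 * D) ^ 3) := by
    rw [norm_smul, Real.norm_natCast]
    gcongr
    refine (norm_mul_le _ _).trans (mul_le_mul ?_ ?_ (norm_nonneg _) (by positivity))
    · refine (norm_sub_le _ _).trans ?_
      rw [norm_smul, Real.norm_eq_abs, abs_of_pos (by norm_num)]
      linarith [norm_nonneg R1]
    · exact norm_pow_mul_pow_le (l := (n - 1) / 3) hΦT hTl (by omega) (hsT _ (by omega))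
  rw [hmain]
  refine (norm_add_le_of_le hfirst hsecond).trans ?_
  have he : 1 ≤ Real.exp 2 := Real.one_le_exp (by norm_num)
  have hD3 : 0 ≤ n * D ^ 3 := by positivity
  have : 2 * Real.exp 2 * 34 ^ 3 ≤ Real.exp 2 ^ 2 * 34 ^ 4 := by nlinarith
  nlinarith [mul_le_mul_of_nonneg_right this hD3]

end PowerExp

/-! ### Atomic signed measures -/

section Atomic

variable {X : Type*} [MeasurableSpace X] [MeasurableSingletonClass X] {ι : Type*} [Countable ι]

/-- Vanishing variation off the countable range makes `M` purely atomic; stated for general `X` so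
as to apply to product measures as well. -/
lemma hasSum_measure_inter_singleton {M : SignedMeasure X} {e : ι → X}
    (he : Function.Injective e) (hM : M.variation (Set.range e)ᶜ = 0) {S : Set X}
    (hS : MeasurableSet S) : HasSum (fun i => M (S ∩ {e i})) (M S) := by
  have hR : MeasurableSet (Set.range e) := (Set.countable_range e).measurableSet
  have h1 := VectorMeasure.hasSum_of_disjoint_iUnion (v := M) (f := fun i => S ∩ {e i})
    (fun i => hS.inter (measurableSet_singleton _))
    (fun i j hij => Disjoint.inter_left' _ (Disjoint.inter_right' _
      (Set.disjoint_singleton.2 (he.ne hij))))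
  have h2 : ⋃ i, S ∩ {e i} = S ∩ Set.range e := by
    rw [← Set.inter_iUnion, Set.iUnion_singleton_eq_range]
  have h3 : M (S \ Set.range e) = 0 :=
    (VectorMeasure.variation_apply_eq_zero hR.compl).1 hM _
      (fun x hx => hx.2) (hS.diff hR)
  have h4 := VectorMeasure.of_union (v := M) (A := S ∩ Set.range e) (B := S \ Set.range e)
    (Set.disjoint_left.2 fun _ hx hx' => hx'.2 hx.2) (hS.inter hR) (hS.diff hR)
  rw [Set.inter_union_sdiff, h3, add_zero] at h4
  rw [h4, ← h2]
  exact h1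

lemma summable_norm_measure_singleton (M : SignedMeasure X) {e : ι → X}
    (he : Function.Injective e) :
    (Summable fun i => |M {e i}|) ∧
      ∑' i, |M {e i}| ≤ (M.variation Set.univ).toReal := by
  have hd : Pairwise (Function.onFun Disjoint fun i => ({e i} : Set X)) := fun i j hij =>
    Set.disjoint_singleton.2 (he.ne hij)
  have hU : M.variation (⋃ i, {e i}) = ∑' i, M.variation {e i} :=
    measure_iUnion hd fun i => measurableSet_singleton _
  have hsum : ∑' i, M.variation {e i} ≠ ⊤ := by
    rw [← hU]; exact measure_ne_top _ _
  have hle : ∀ i, |M {e i}| ≤ (M.variation {e i}).toReal := fun i => by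
    have h := ENNReal.toReal_mono (measure_ne_top _ _)
      (VectorMeasure.enorm_measure_le_variation M {e i})
    simpa using h
  have hs : Summable fun i => (M.variation {e i}).toReal := ENNReal.summable_toReal hsum
  have hs' : Summable fun i => |M {e i}| := hs.of_nonneg_of_le (fun _ => abs_nonneg _) hle
  refine ⟨hs', (hs'.tsum_le_tsum hle hs).trans ?_⟩
  rw [← ENNReal.tsum_toReal_eq (fun _ => measure_ne_top _ _), ← hU]
  exact ENNReal.toReal_mono (measure_ne_top _ _) (measure_mono (Set.subset_univ _))

end Atomic

/-! ### Lattice measures in a Banach algebra -/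

section Lattice

variable {d : ℕ}

lemma latticePoint_injective : Function.Injective (latticePoint (d := d)) := fun a b h => by
  funext i
  have := congrFun h i
  simpa [latticePoint] using this

lemma latticePoint_zero : latticePoint (0 : Fin d → ℤ) = 0 := by
  funext i; simp [latticePoint]

lemma latticePoint_add (a b : Fin d → ℤ) :
    latticePoint (a + b) = latticePoint a + latticePoint b := by
  funext i; simp [latticePoint]

lemma latticePoint_neg (a : Fin d → ℤ) : latticePoint (-a) = -latticePoint a := by
  funext i; simp [latticePoint]

lemma measurableSet_range_latticePoint : MeasurableSet (Set.range (latticePoint (d := d))) :=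
  (Set.countable_range _).measurableSet

variable {A : Type*} [NormedRing A] [NormedAlgebra ℝ A] {τ : (Fin d → ℤ) → A}

/-- The image of (the lattice part of) a signed measure under the extension to measures of a
representation `τ` of `ℤ^d`. -/
noncomputable def convOperator (τ : (Fin d → ℤ) → A) (M : SignedMeasure (Fin d → ℝ)) : A :=
  ∑' m : Fin d → ℤ, M {latticePoint m} • τ m

lemma summable_norm_mass_smul (hτ : ∀ m, ‖τ m‖ ≤ 1) (M : SignedMeasure (Fin d → ℝ)) :
    Summable fun m : Fin d → ℤ => ‖M {latticePoint m} • τ m‖ :=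
  summable_norm_smul_of_norm_le_one hτ
    (summable_norm_measure_singleton M latticePoint_injective).1

lemma convOperator_unit (h0 : τ 0 = 1) : convOperator τ (unit (Fin d → ℝ)) = 1 := by
  rw [convOperator, tsum_eq_single 0]
  · simp [unit, latticePoint_zero, h0, Measure.real]
  · intro m hm
    have : latticePoint m ≠ 0 := by
      rw [← latticePoint_zero]; exact latticePoint_injective.ne hm
    have h0 : unit (Fin d → ℝ) {latticePoint m} = 0 := by
      simp [unit, Measure.real, this.symm]
    rw [h0, zero_smul]

variable [CompleteSpace A]

lemma hasSum_convOperator (hτ : ∀ m, ‖τ m‖ ≤ 1) (M : SignedMeasure (Fin d → ℝ)) :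
    HasSum (fun m : Fin d → ℤ => M {latticePoint m} • τ m) (convOperator τ M) :=
  (summable_norm_mass_smul hτ M).of_norm.hasSum

lemma convOperator_sub (hτ : ∀ m, ‖τ m‖ ≤ 1) (M V : SignedMeasure (Fin d → ℝ)) :
    convOperator τ (M - V) = convOperator τ M - convOperator τ V := by
  rw [← ((hasSum_convOperator hτ M).sub (hasSum_convOperator hτ V)).tsum_eq]
  exact tsum_congr fun m => by rw [_root_.sub_apply, sub_smul]

lemma convOperator_smul (hτ : ∀ m, ‖τ m‖ ≤ 1) (c : ℝ) (M : SignedMeasure (Fin d → ℝ)) :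
    convOperator τ (c • M) = c • convOperator τ M := by
  rw [← ((hasSum_convOperator hτ M).const_smul c).tsum_eq]
  exact tsum_congr fun m => by rw [_root_.smul_apply, smul_eq_mul, mul_smul]

/-- A signed measure on `ℝ^d` that does not charge the complement of the lattice `ℤ^d`. -/
def LatticeSupported (M : SignedMeasure (Fin d → ℝ)) : Prop :=
  M.variation (Set.range (latticePoint (d := d)))ᶜ = 0

lemma latticeSupported_iff {M : SignedMeasure (Fin d → ℝ)} : LatticeSupported M ↔
    ∀ t, t ⊆ (Set.range (latticePoint (d := d)))ᶜ → MeasurableSet t → M t = 0 :=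
  VectorMeasure.variation_apply_eq_zero measurableSet_range_latticePoint.compl

lemma LatticeSupported.sub {M V : SignedMeasure (Fin d → ℝ)} (hM : LatticeSupported M)
    (hV : LatticeSupported V) : LatticeSupported (M - V) := by
  rw [latticeSupported_iff] at *
  intro t ht htm
  rw [_root_.sub_apply, hM t ht htm, hV t ht htm, sub_zero]

lemma LatticeSupported.smul {M : SignedMeasure (Fin d → ℝ)} (hM : LatticeSupported M) (c : ℝ) :
    LatticeSupported (c • M) := by
  rw [latticeSupported_iff] at *
  intro t ht htm
  rw [_root_.smul_apply, hM t ht htm, smul_zero]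

lemma latticeSupported_unit : LatticeSupported (unit (Fin d → ℝ)) := by
  rw [LatticeSupported, unit, Measure.variation_toSignedMeasure,
    Measure.dirac_apply' _ measurableSet_range_latticePoint.compl, Set.indicator_of_notMem]
  exact fun h => h ⟨0, latticePoint_zero⟩

lemma variation_conv_le (M V : SignedMeasure (Fin d → ℝ)) {S : Set (Fin d → ℝ)}
    (hS : MeasurableSet S) : (conv M V).variation S ≤
      ‖ContinuousLinearMap.mul ℝ ℝ‖ₑ * (M.variation.prod V.variation) {p | p.1 + p.2 ∈ S} := by
  have h1 := VectorMeasure.variation_map_le (μ := M.prod V (ContinuousLinearMap.mul ℝ ℝ))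
    (φ := fun p : (Fin d → ℝ) × (Fin d → ℝ) => p.1 + p.2) S
  rw [Measure.map_apply measurable_add hS] at h1
  exact h1.trans (VectorMeasure.variation_prod_le _)

lemma variation_prod_compl_range_eq_zero {M V : SignedMeasure (Fin d → ℝ)}
    (hM : LatticeSupported M) (hV : LatticeSupported V) :
    (M.variation.prod V.variation)
      (Set.range (Prod.map (latticePoint (d := d)) (latticePoint (d := d))))ᶜ = 0 := by
  have h : (Set.range (Prod.map (latticePoint (d := d)) (latticePoint (d := d))))ᶜ
      ⊆ (Set.range (latticePoint (d := d)))ᶜ ×ˢ Set.univ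
        ∪ Set.univ ×ˢ (Set.range (latticePoint (d := d)))ᶜ := by
    rw [Set.range_prodMap, Set.compl_prod_eq_union]
  refine measure_mono_null h (measure_union_null ?_ ?_)
  · rw [Measure.prod_prod, hM, zero_mul]
  · rw [Measure.prod_prod, hV, mul_zero]

lemma LatticeSupported.conv {M V : SignedMeasure (Fin d → ℝ)} (hM : LatticeSupported M)
    (hV : LatticeSupported V) : LatticeSupported (conv M V) := by
  have h := variation_conv_le M V (measurableSet_range_latticePoint (d := d)).compl
  refine le_antisymm (h.trans_eq ?_) bot_le
  rw [measure_mono_null ?_ (variation_prod_compl_range_eq_zero hM hV), mul_zero]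
  rintro p hp ⟨q, rfl⟩
  exact hp ⟨q.1 + q.2, latticePoint_add _ _⟩

/-- The product measure lives on pairs of lattice points, so the preimage of a point under addition
is measured atom by atom. -/
lemma hasSum_conv_singleton {M V : SignedMeasure (Fin d → ℝ)} (hM : LatticeSupported M)
    (hV : LatticeSupported V) (k : Fin d → ℤ) :
    HasSum (fun p : (Fin d → ℤ) × (Fin d → ℤ) => if p.1 + p.2 = k then
      M {latticePoint p.1} * V {latticePoint p.2} else 0) (CPApprox.conv M V {latticePoint k}) := by
  have hinj : Function.Injective (Prod.map (latticePoint (d := d)) (latticePoint (d := d))) :=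
    latticePoint_injective.prodMap latticePoint_injective
  have hvar : (M.prod V (ContinuousLinearMap.mul ℝ ℝ)).variation
      (Set.range (Prod.map (latticePoint (d := d)) (latticePoint (d := d))))ᶜ = 0 := by
    refine le_antisymm ((VectorMeasure.variation_prod_le _).trans_eq ?_) bot_le
    rw [Measure.smul_apply, variation_prod_compl_range_eq_zero hM hV, smul_zero]
  have hmeas : MeasurableSet
      ((fun p : (Fin d → ℝ) × (Fin d → ℝ) => p.1 + p.2) ⁻¹' {latticePoint k}) :=
    measurable_add (measurableSet_singleton _)
  have h := hasSum_measure_inter_singleton hinj hvar hmeas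
  rw [← VectorMeasure.map_apply _ measurable_add (measurableSet_singleton _)] at h
  convert! h using 2 with p
  have hiff : Prod.map latticePoint latticePoint p ∈
      (fun p : (Fin d → ℝ) × (Fin d → ℝ) => p.1 + p.2) ⁻¹' {latticePoint k} ↔ p.1 + p.2 = k := by
    rw [Set.mem_preimage, Set.mem_singleton_iff, ← latticePoint_injective.eq_iff,
      latticePoint_add]
    rfl
  split_ifs with hp
  · rw [Set.inter_eq_right.2 (Set.singleton_subset_iff.2 (hiff.2 hp)), Prod.map,
      ← Set.singleton_prod_singleton, VectorMeasure.prod_apply]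
    rfl
  · rw [Set.inter_singleton_eq_empty.2 (mt hiff.1 hp), VectorMeasure.empty]

/-- The absolutely convergent product of the two series is regrouped along the fibres of addition.
-/
lemma convOperator_conv (hadd : ∀ a b, τ (a + b) = τ a * τ b) (hτ : ∀ m, ‖τ m‖ ≤ 1)
    {M V : SignedMeasure (Fin d → ℝ)} (hM : LatticeSupported M)
    (hV : LatticeSupported V) :
    convOperator τ (conv M V) = convOperator τ M * convOperator τ V := by
  have h1 := summable_mul_of_summable_norm (summable_norm_mass_smul hτ M)
    (summable_norm_mass_smul hτ V)
  have h2 : convOperator τ M * convOperator τ V = ∑' p : (Fin d → ℤ) × (Fin d → ℤ),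
      (M {latticePoint p.1} • τ p.1) * (V {latticePoint p.2} • τ p.2) :=
    tsum_mul_tsum_of_summable_norm (summable_norm_mass_smul hτ M)
      (summable_norm_mass_smul hτ V)
  have h3 := h1.hasSum.tsum_fiberwise (fun p : (Fin d → ℤ) × (Fin d → ℤ) => p.1 + p.2)
  rw [h2, ← h3.tsum_eq]
  refine tsum_congr fun k => ?_
  rw [tsum_subtype ((fun p : (Fin d → ℤ) × (Fin d → ℤ) => p.1 + p.2) ⁻¹' {k})
    (fun p => (M {latticePoint p.1} • τ p.1) * (V {latticePoint p.2} • τ p.2)),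
    ← ((hasSum_conv_singleton hM hV k).smul_const (τ k)).tsum_eq]
  refine tsum_congr fun p => ?_
  by_cases hp : p.1 + p.2 = k
  · rw [if_pos hp, Set.indicator_of_mem (by exact hp), smul_mul_smul_comm, ← hadd, hp]
  · rw [if_neg hp, Set.indicator_of_notMem (by exact hp), zero_smul]

lemma LatticeSupported.convPow {M : SignedMeasure (Fin d → ℝ)} (hM : LatticeSupported M)
    (j : ℕ) : LatticeSupported (convPow M j) := by
  induction j with
  | zero => exact latticeSupported_unit
  | succ j ih => exact ih.conv hM

lemma convOperator_convPow (h0 : τ 0 = 1) (hadd : ∀ a b, τ (a + b) = τ a * τ b) (hτ : ∀ m, ‖τ m‖ ≤ 1)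
    {M : SignedMeasure (Fin d → ℝ)} (hM : LatticeSupported M) (j : ℕ) :
    convOperator τ (convPow M j) = convOperator τ M ^ j := by
  induction j with
  | zero => rw [pow_zero]; exact convOperator_unit h0
  | succ j ih => rw [pow_succ, ← ih]; exact convOperator_conv hadd hτ (hM.convPow j) hM

lemma LatticeSupported.expMeasure {M : SignedMeasure (Fin d → ℝ)} (hM : LatticeSupported M) :
    LatticeSupported (expMeasure M) := by
  rw [latticeSupported_iff]
  intro t ht htm
  have h : CPApprox.expMeasure M t = ∑' j : ℕ, CPApprox.convPow M j t / (j.factorial : ℝ) := rfl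
  rw [h]
  simp only [latticeSupported_iff.1 (hM.convPow _) t ht htm, zero_div, tsum_zero]

/-- The sums over powers and over lattice points may be exchanged, because the `j`-th row has
absolute sum at most `v ^ j / j!`, with `v` the total variation of `M`. -/
lemma convOperator_expMeasure (h0 : τ 0 = 1) (hadd : ∀ a b, τ (a + b) = τ a * τ b) (hτ : ∀ m, ‖τ m‖ ≤ 1)
    {M : SignedMeasure (Fin d → ℝ)} (hM : LatticeSupported M) :
    convOperator τ (expMeasure M) = NormedSpace.exp (convOperator τ M) := by
  set v : ℝ := (M.variation Set.univ).toReal with hv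
  have hbound : ∀ j, ∑' m : Fin d → ℤ, |convPow M j {latticePoint m}| ≤ v ^ j := fun j => by
    refine (summable_norm_measure_singleton _ latticePoint_injective).2.trans ?_
    rw [hv, ← ENNReal.toReal_pow]
    exact ENNReal.toReal_mono (ENNReal.pow_ne_top (measure_ne_top _ _))
      (variation_convPow_univ_le M j)
  have hkey : Summable fun p : ℕ × (Fin d → ℤ) =>
      |convPow M p.1 {latticePoint p.2}| / (p.1.factorial : ℝ) := by
    have hnn : ∀ p : ℕ × (Fin d → ℤ),
        0 ≤ |convPow M p.1 {latticePoint p.2}| / (p.1.factorial : ℝ) :=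
      fun p => div_nonneg (abs_nonneg _) (Nat.cast_nonneg _)
    rw [summable_prod_of_nonneg hnn]
    have hrow : ∀ j : ℕ, Summable fun m : Fin d → ℤ => |convPow M j {latticePoint m}| :=
      fun j => (summable_norm_measure_singleton _ latticePoint_injective).1
    refine ⟨fun j => (hrow j).div_const (j.factorial : ℝ), ?_⟩
    refine (Real.summable_pow_div_factorial v).of_nonneg_of_le
      (fun j => tsum_nonneg fun i => hnn (j, i)) fun j => ?_
    refine (tsum_div_const (f := fun m : Fin d → ℤ => |convPow M j {latticePoint m}|)
      (a := (j.factorial : ℝ))).trans_le ?_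
    exact div_le_div_of_nonneg_right (hbound j) (Nat.cast_nonneg _)
  have hS : Summable fun p : ℕ × (Fin d → ℤ) =>
      (convPow M p.1 {latticePoint p.2} / (p.1.factorial : ℝ)) • τ p.2 := by
    refine Summable.of_norm_bounded hkey fun p => ?_
    rw [norm_smul, Real.norm_eq_abs, abs_div, Nat.abs_cast]
    exact mul_le_of_le_one_right (by positivity) (hτ _)
  have hs : ∀ m : Fin d → ℤ,
      Summable fun j : ℕ => convPow M j {latticePoint m} / (j.factorial : ℝ) := fun m => by
    have : Summable fun j : ℕ => |convPow M j {latticePoint m}| / (j.factorial : ℝ) :=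
      hkey.prod_symm.prod_factor m
    refine Summable.of_norm ?_
    simpa only [norm_div, Real.norm_eq_abs, Nat.abs_cast] using this
  have he : ∀ m : Fin d → ℤ, expMeasure M {latticePoint m} • τ m
      = ∑' j : ℕ, (convPow M j {latticePoint m} / (j.factorial : ℝ)) • τ m := fun m =>
    ((hs m).tsum_smul_const (τ m)).symm
  have h1 : convOperator τ (expMeasure M) = ∑' (m : Fin d → ℤ) (j : ℕ),
      (convPow M j {latticePoint m} / (j.factorial : ℝ)) • τ m :=
    tsum_congr he
  have hcomm : ∑' (m : Fin d → ℤ) (j : ℕ),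
      (convPow M j {latticePoint m} / (j.factorial : ℝ)) • τ m
      = ∑' (j : ℕ) (m : Fin d → ℤ),
      (convPow M j {latticePoint m} / (j.factorial : ℝ)) • τ m :=
    Summable.tsum_comm (f := fun (j : ℕ) (m : Fin d → ℤ) =>
      (convPow M j {latticePoint m} / (j.factorial : ℝ)) • τ m) hS
  rw [h1, hcomm, NormedSpace.exp_eq_tsum ℝ]
  refine tsum_congr fun j => ?_
  rw [← convOperator_convPow h0 hadd hτ hM, ← ((hasSum_convOperator hτ (convPow M j)).const_smul
    ((j.factorial : ℝ)⁻¹)).tsum_eq]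
  exact tsum_congr fun m => by rw [smul_smul, div_eq_inv_mul]

end Lattice

/-! ### Translations of bounded functions on the lattice -/

section Translation

open BoundedContinuousFunction

variable {d : ℕ}

/-- Ensures that the identity operator has norm one, as the Banach algebra estimates require. -/
lemma nontrivial_boundedContinuousFunction {X : Type*} [TopologicalSpace X] [Nonempty X] :
    Nontrivial (X →ᵇ ℝ) :=
  ⟨const X 0, const X 1, fun h => by
    have := DFunLike.congr_fun h (Classical.arbitrary X)
    simp at this⟩

lemma hasSum_functional_convOperator_apply {B : Type*} [NormedAddCommGroup B] [NormedSpace ℝ B]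
    [CompleteSpace B] {τ : (Fin d → ℤ) → (B →L[ℝ] B)} (hτ : ∀ m, ‖τ m‖ ≤ 1)
    (M : SignedMeasure (Fin d → ℝ)) (φ : B →L[ℝ] ℝ) (f : B) :
    HasSum (fun m : Fin d → ℤ => M {latticePoint m} * φ (τ m f)) (φ (convOperator τ M f)) := by
  have h := φ.hasSum ((ContinuousLinearMap.apply ℝ B f).hasSum (hasSum_convOperator hτ M))
  simpa using h

/-- Translation of bounded functions on the lattice. -/
noncomputable def translation (m : Fin d → ℤ) : ((Fin d → ℤ) →ᵇ ℝ) →L[ℝ] ((Fin d → ℤ) →ᵇ ℝ) :=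
  LinearMap.mkContinuous
    { toFun := fun f => f.compContinuous ⟨fun x => x + m, by fun_prop⟩
      map_add' := fun _ _ => rfl
      map_smul' := fun _ _ => rfl } 1 fun f => by
    rw [one_mul]
    exact (norm_le (norm_nonneg f)).2 fun x => f.norm_coe_le_norm (x + m)

lemma translation_apply (m : Fin d → ℤ) (f : (Fin d → ℤ) →ᵇ ℝ) (x : Fin d → ℤ) :
    translation m f x = f (x + m) := rfl

lemma translation_zero : translation (0 : Fin d → ℤ) = 1 := by
  ext f x
  rw [translation_apply, add_zero]; rfl

lemma translation_add (a b : Fin d → ℤ) :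
    translation (a + b) = translation a * translation b := by
  ext f x
  rw [mul_apply_eq_comp, translation_apply, translation_apply, translation_apply,
    add_assoc]

lemma norm_translation_le (m : Fin d → ℤ) : ‖translation m‖ ≤ 1 :=
  LinearMap.mkContinuous_norm_le _ zero_le_one _

/-- Applying the operator to the indicator of `S`, of norm at most one, and evaluating at the origin
returns `M S`. -/
lemma abs_apply_le_norm_convOperator {M : SignedMeasure (Fin d → ℝ)} (hM : LatticeSupported M)
    {S : Set (Fin d → ℝ)} (hS : MeasurableSet S) : |M S| ≤ ‖convOperator translation M‖ := by
  classical
  set f : (Fin d → ℤ) →ᵇ ℝ := BoundedContinuousFunction.ofNormedAddCommGroupDiscrete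
    (fun m => if latticePoint m ∈ S then 1 else 0) 1 (fun m => by split_ifs <;> simp) with hf
  have hf1 : ‖f‖ ≤ 1 := (norm_le zero_le_one).2 fun m => by
    simp only [hf, coe_ofNormedAddCommGroupDiscrete]
    split_ifs <;> simp
  have h1 : HasSum (fun m : Fin d → ℤ => M {latticePoint m} * f m) (convOperator translation M f 0) := by
    have h := hasSum_functional_convOperator_apply norm_translation_le M
      (evalCLM ℝ (0 : Fin d → ℤ)) f
    have e : ∀ m : Fin d → ℤ, evalCLM ℝ (0 : Fin d → ℤ) (translation m f) = f m := fun m => by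
      rw [evalCLM_apply, translation_apply, zero_add]
    simp only [e] at h
    exact h
  have h2 := hasSum_measure_inter_singleton latticePoint_injective hM hS
  have h3 : M S = convOperator translation M f 0 := by
    rw [← h1.tsum_eq, ← h2.tsum_eq]
    refine tsum_congr fun m => ?_
    simp only [hf, coe_ofNormedAddCommGroupDiscrete]
    split_ifs with hm
    · rw [Set.inter_eq_right.2 (Set.singleton_subset_iff.2 hm), mul_one]
    · rw [Set.inter_singleton_eq_empty.2 hm, VectorMeasure.empty, mul_zero]
  rw [h3, ← Real.norm_eq_abs]
  refine ((convOperator translation M f).norm_coe_le_norm 0).trans (((convOperator translation M).le_opNorm f).trans ?_)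
  exact mul_le_of_le_one_right (norm_nonneg _) hf1

end Translation

/-! ### The expansion bound for lattice distributions -/

section Expansion

variable {d : ℕ}

lemma latticeSupported_toSignedMeasure {F : Measure (Fin d → ℝ)} [IsFiniteMeasure F]
    (hF : F.support ⊆ Set.range (latticePoint (d := d))) :
    LatticeSupported F.toSignedMeasure := by
  rw [LatticeSupported, Measure.variation_toSignedMeasure]
  exact measure_mono_null (Set.compl_subset_compl.2 hF) Measure.measure_compl_support

lemma hasSum_real_latticePoint {F : Measure (Fin d → ℝ)} [IsProbabilityMeasure F]
    (hF : F.support ⊆ Set.range (latticePoint (d := d))) :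
    HasSum (fun m : Fin d → ℤ => F.real {latticePoint m}) 1 := by
  have h := hasSum_measure_inter_singleton latticePoint_injective
    (latticeSupported_toSignedMeasure hF) MeasurableSet.univ
  simpa [Measure.toSignedMeasure_apply_measurable] using h

lemma convOperator_toSignedMeasure {A : Type*} [NormedRing A] [NormedAlgebra ℝ A]
    (τ : (Fin d → ℤ) → A) (F : Measure (Fin d → ℝ)) [IsFiniteMeasure F] :
    convOperator τ F.toSignedMeasure = ∑' m, F.real {latticePoint m} • τ m :=
  tsum_congr fun m => by
    rw [Measure.toSignedMeasure_apply_measurable (measurableSet_singleton _)]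

lemma tvDist_le_norm_convOperator_sub {M V : SignedMeasure (Fin d → ℝ)}
    (hM : LatticeSupported M) (hV : LatticeSupported V) :
    tvDist M V ≤ ‖convOperator translation M - convOperator translation V‖ := by
  have : Nonempty {B : Set (Fin d → ℝ) // MeasurableSet B} := ⟨⟨∅, MeasurableSet.empty⟩⟩
  refine ciSup_le fun B => ?_
  rw [← _root_.sub_apply, ← convOperator_sub norm_translation_le]
  exact abs_apply_le_norm_convOperator (hM.sub hV) B.2

/-- Termwise scaling by `y`; the factor `e` inside `delta` is only bounded below by one. -/
lemma tsum_min_le_delta_div {F : Measure (Fin d → ℝ)} [IsProbabilityMeasure F]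
    (hF : F.support ⊆ Set.range (latticePoint (d := d))) {y : ℝ} (hy : 0 < y) :
    ∑' m : {m : Fin d → ℤ // m ≠ 0}, min (F.real {latticePoint m.1}) (1 / y)
      ≤ delta F y / y := by
  have hS : Summable fun m : {m : Fin d → ℤ // m ≠ 0} => F.real {latticePoint m.1} :=
    (hasSum_real_latticePoint hF).summable.subtype _
  have hS1 : Summable fun m : {m : Fin d → ℤ // m ≠ 0} =>
      min (F.real {latticePoint m.1}) (1 / y) :=
    hS.of_nonneg_of_le (fun m => le_min measureReal_nonneg (by positivity))
      fun m => min_le_left _ _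
  have hS2 : Summable fun m : {m : Fin d → ℤ // m ≠ 0} =>
      min 1 (y * Real.exp 1 * F.real {latticePoint m.1}) :=
    (hS.mul_left (y * Real.exp 1)).of_nonneg_of_le
      (fun m => le_min zero_le_one (by positivity)) fun m => min_le_right _ _
  rw [delta, ← tsum_div_const]
  refine hS1.tsum_le_tsum (fun m => ?_) (hS2.div_const y)
  rw [le_div_iff₀ hy, le_min_iff]
  constructor
  · calc _ ≤ 1 / y * y := mul_le_mul_of_nonneg_right (min_le_right _ _) hy.le
      _ = 1 := by field_simp
  · calc _ ≤ F.real {latticePoint m.1} * y := mul_le_mul_of_nonneg_right (min_le_left _ _) hy.le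
      _ = y * 1 * F.real {latticePoint m.1} := by ring
      _ ≤ _ := by
        gcongr
        exact Real.one_le_exp zero_le_one

/-- The expansion bound in an arbitrary Banach algebra representation of the lattice. -/
lemma norm_convOperator_convPow_sub_le {A : Type*} [NormedRing A] [NormedAlgebra ℝ A]
    [CompleteSpace A] [NormOneClass A] {τ : (Fin d → ℤ) → A} (h0 : τ 0 = 1)
    (hadd : ∀ a b, τ (a + b) = τ a * τ b) (hτ : ∀ m, ‖τ m‖ ≤ 1)
    {F : Measure (Fin d → ℝ)} [IsProbabilityMeasure F] [F.IsNegInvariant]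
    (hsupp : F.support ⊆ Set.range (latticePoint (d := d))) {q : ℝ} (hq : q = F.real {0})
    (hq0 : 0 < q) (hq1 : q < 1) {n : ℕ} (hn : 1 ≤ n) :
    ‖convOperator τ (convPow F.toSignedMeasure n) -
        convOperator τ (conv (expMeasure ((n : ℝ) • (F.toSignedMeasure - unit (Fin d → ℝ))))
          (unit (Fin d → ℝ) -
            ((n : ℝ) / 2) • convPow (F.toSignedMeasure - unit (Fin d → ℝ)) 2))‖
      ≤ Real.exp 2 ^ 2 * 34 ^ 4 * (delta F (n * q) ^ 3 + delta F (n * q) ^ 4) /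
          (q ^ (11 / 2 : ℝ) * (n : ℝ) ^ 2) := by
  set K : ℝ := Real.exp 2 ^ 2 * 34 ^ 4 with hK
  have hn0 : (0 : ℝ) < n := by exact_mod_cast hn
  have hFL := latticeSupported_toSignedMeasure hsupp
  have hΦL := hFL.sub latticeSupported_unit
  set p : (Fin d → ℤ) → ℝ := fun m => F.real {latticePoint m} with hp
  have hp0 : p 0 = q := by rw [hp, hq, ← latticePoint_zero]
  have hpn : ∀ m, 0 ≤ p m := fun m => measureReal_nonneg
  have hp1 : HasSum p 1 := hasSum_real_latticePoint hsupp
  have hps : ∀ m, p (-m) = p m := fun m => by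
    simp only [hp, Measure.real]
    rw [latticePoint_neg, ← Set.neg_singleton, Measure.measure_neg]
  set T := convOperator τ F.toSignedMeasure with hT
  have hTs : T = ∑' m, p m • τ m :=
    convOperator_toSignedMeasure _ F
  have hTn : ‖T‖ ≤ 1 := by
    rw [hTs]
    have habs : (fun m => |p m|) = p := funext fun m => abs_of_nonneg (hpn m)
    refine (norm_tsum_smul_le hτ (by rw [habs]; exact hp1.summable)).trans_eq ?_
    rw [habs, hp1.tsum_eq]
  set D := ∑' m : {m : Fin d → ℤ // m ≠ 0}, min (p m) (1 / (n * q)) with hD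
  have hDn : 0 ≤ D := tsum_nonneg fun m => le_min (hpn m) (by positivity)
  have hDδ : D ≤ delta F (n * q) / (n * q) :=
    tsum_min_le_delta_div hsupp (by positivity)
  have hsmooth : ∀ k : ℕ, ‖(T - 1) * T ^ k‖ ≤ 2 * (1 + n / (k + 1)) * D := fun k => by
    have := norm_sub_one_mul_pow_le h0 hadd hτ hpn hp1 hps (by rw [hp0]; exact hq0) hn k
    rwa [← hTs, hp0] at this
  have hmain := norm_pow_sub_exp_mul_le hTn hn hDn hsmooth
  have hE := (hΦL.smul (n : ℝ)).expMeasure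
  have hS := latticeSupported_unit.sub ((hΦL.convPow 2).smul ((n : ℝ) / 2))
  rw [convOperator_conv hadd hτ hE hS,
    convOperator_expMeasure h0 hadd hτ (hΦL.smul (n : ℝ)),
    convOperator_sub hτ (unit _), convOperator_smul hτ,
    convOperator_smul hτ, convOperator_convPow h0 hadd hτ hΦL,
    convOperator_convPow h0 hadd hτ hFL, convOperator_sub hτ,
    convOperator_unit h0, ← hT]
  refine hmain.trans ?_
  set δ := delta F (n * q) with hδ
  have hδ0 : 0 ≤ δ := tsum_nonneg fun m => le_min zero_le_one (by positivity)
  -- The argument produces `q ^ 3` and `q ^ 4` in the denominators; both are weakened to the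
  -- exponent `11/2`, as `q < 1`.
  have hq4 : q ^ (11 / 2 : ℝ) ≤ q ^ 4 := by
    rw [← Real.rpow_natCast q 4]
    exact Real.rpow_le_rpow_of_exponent_ge hq0 hq1.le (by norm_num)
  have hqr : 0 < q ^ (11 / 2 : ℝ) := Real.rpow_pos_of_pos hq0 _
  have hq43 : q ^ 4 ≤ q ^ 3 := pow_le_pow_of_le_one hq0.le hq1.le (by norm_num)
  have hbound : n * D ^ 3 + n ^ 2 * D ^ 4 ≤ (δ ^ 3 + δ ^ 4) / (q ^ (11 / 2 : ℝ) * (n : ℝ) ^ 2) := by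
    calc (n : ℝ) * D ^ 3 + n ^ 2 * D ^ 4
        ≤ n * (δ / (n * q)) ^ 3 + n ^ 2 * (δ / (n * q)) ^ 4 := by gcongr
      _ = δ ^ 3 / (q ^ 3 * (n : ℝ) ^ 2) + δ ^ 4 / (q ^ 4 * (n : ℝ) ^ 2) := by field_simp
      _ ≤ δ ^ 3 / (q ^ (11 / 2 : ℝ) * (n : ℝ) ^ 2)
          + δ ^ 4 / (q ^ (11 / 2 : ℝ) * (n : ℝ) ^ 2) := by
        have := hq4.trans hq43
        gcongr
      _ = _ := (add_div _ _ _).symm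
  rw [mul_div_assoc]
  exact mul_le_mul_of_nonneg_left hbound (by positivity)

end Expansion

end CPApprox

theorem theorem3 :
    ∃ C : ℝ, 0 < C ∧
      ∀ (d : ℕ) (F : Measure (Fin d → ℝ)) [IsProbabilityMeasure F],
        F.IsNegInvariant →
        F.support ⊆ Set.range (CPApprox.latticePoint (d := d)) →
        ∀ q : ℝ, q = F.real {0} → q ∈ Set.Ioo (0 : ℝ) 1 →
        ∀ n : ℕ, 1 ≤ n →
          CPApprox.tvDist
              (CPApprox.convPow F.toSignedMeasure n)
              (CPApprox.conv
                (CPApprox.expMeasure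
                  ((n : ℝ) • (F.toSignedMeasure - CPApprox.unit (Fin d → ℝ))))
                (CPApprox.unit (Fin d → ℝ) -
                  ((n : ℝ) / 2) •
                    CPApprox.convPow (F.toSignedMeasure - CPApprox.unit (Fin d → ℝ)) 2))
            ≤ C * (CPApprox.delta F (n * q) ^ 3 + CPApprox.delta F (n * q) ^ 4) /
                  (q ^ (11 / 2 : ℝ) * (n : ℝ) ^ 2) +
                C * (1 - q) ^ 6 / (q ^ (13 / 2 : ℝ) * (n : ℝ) ^ 2) := by
  refine ⟨Real.exp 2 ^ 2 * 34 ^ 4, by positivity, ?_⟩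
  intro d F _ hneg hsupp q hq ⟨hq0, hq1⟩ n hn
  have hFL := CPApprox.latticeSupported_toSignedMeasure hsupp
  have hΦL := hFL.sub CPApprox.latticeSupported_unit
  have hE := (hΦL.smul (n : ℝ)).expMeasure
  have hS := CPApprox.latticeSupported_unit.sub ((hΦL.convPow 2).smul ((n : ℝ) / 2))
  have := CPApprox.nontrivial_boundedContinuousFunction (X := Fin d → ℤ)
  have h1q : 0 ≤ 1 - q := by linarith
  calc _ ≤ _ := CPApprox.tvDist_le_norm_convOperator_sub (hFL.convPow n) (hE.conv hS)
    _ ≤ _ := CPApprox.norm_convOperator_convPow_sub_le CPApprox.translation_zero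
      CPApprox.translation_add CPApprox.norm_translation_le hsupp hq hq0 hq1 hn
    -- The summand with `(1 - q) ^ 6` enters only through its nonnegativity.
    _ ≤ _ := le_add_of_nonneg_right (by positivity)
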